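/- A digraph $D$ consists of a vertex set and a set of ordered pairs of vertices, its edges. For $s\ge 0$, an $s$-arc from $u$ to $v$ is a sequence of vertices $u=u_0,u_1,\dots,u_s=v$ such that $(u_i,u_{i+1})$ is an edge for $0\le i<s$ and $u_{i-1}\ne u_{i+1}$ for $0<i<s$. The digraph is distance-transitive if, for every $s\ge 0$, its automorphism group $\mathrm{Aut}(D)$ is transitive on the set of ordered pairs $(u,v)$ of vertices for which there is an $s$-arc from $u$ to $v$ but no $t$-arc from $u$ to $v$ with $t<s$. It is primitive if $\mathrm{Aut}(D)$ acts transitively on the vertices and the only equivalence relations on the vertex set preserved by $\mathrm{Aut}(D)$ are equality and the universal relation. A directed cycle consists of distinct vertices $c_0,\dots,c_{n-1}$ with $n\ge 1$ such that $(c_i,c_{i+1})$ is an edge for $0\le i<n-1$ and $(c_{n-1},c_0)$ is an edge; in particular, a loop or a pair of opposite edges is a directed cycle. The descendant subdigraph of a vertex $\alpha$ is the full induced subdigraph on the set of all vertices $v$ for which there is an $s$-arc from $\alpha$ to $v$ for some $s\ge 0$. A digraph is a rooted tree with root $r$ if it has no loops and no pair of opposite edges, its underlying undirected graph is a tree, and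 for every vertex $v$ it contains an $s$-arc from $r$ to $v$ for some $s\ge0$. **Theorem 1.1.** Let $D$ be an infinite, primitive, distance-transitive digraph with no directed cycles, and suppose that every vertex of $D$ has exactly $p^2$ out-neighbours, where $p$ is a prime. Then, for every vertex $\alpha$ of $D$, the descendant subdigraph of $\alpha$ is a rooted tree with root $\alpha$. -/

import Mathlib

namespace Digraph

variable {V : Type*}

/-- `u 0, u 1, …, u s` is an `s`-arc (directed path of length `s`) from `x` to `y`: consecutive
vertices are joined by edges and `u (i - 1) ≠ u (i + 1)` for `0 < i < s`.
Only the values `u 0, …, u s` matter. -/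
structure IsArc (D : Digraph V) (s : ℕ) (x y : V) (u : ℕ → V) : Prop where
  start : u 0 = x
  finish : u s = y
  adj : ∀ i, i < s → D.Adj (u i) (u (i + 1))
  ne : ∀ i, i + 2 ≤ s → u i ≠ u (i + 2)

/-- There is an `s`-arc from `x` to `y`. -/
def HasArc (D : Digraph V) (s : ℕ) (x y : V) : Prop :=
  ∃ u : ℕ → V, D.IsArc s x y u

/-- There is an `s`-arc from `x` to `y`, but no `t`-arc for any `t < s`. -/
def AtDist (D : Digraph V) (s : ℕ) (x y : V) : Prop :=
  D.HasArc s x y ∧ ∀ t, t < s → ¬ D.HasArc t x y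

/-- The automorphism group of a digraph, acting on the vertices. -/
abbrev Aut (D : Digraph V) : Type _ := D.Adj ≃r D.Adj

/-- For every `s ≥ 0` the automorphism group is transitive on the pairs at distance `s`. -/
def IsDistanceTransitive (D : Digraph V) : Prop :=
  ∀ s : ℕ, ∀ x y x' y' : V, D.AtDist s x y → D.AtDist s x' y' →
    ∃ g : D.Aut, g x = x' ∧ g y = y'

/-- The automorphism group is primitive on the vertex set. -/
def IsPrimitive (D : Digraph V) : Prop :=
  MulAction.IsPreprimitive D.Aut V

/-- Some distinct vertices `c 0, …, c (n - 1)`, `n ≥ 1`, satisfy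
`c 0 → c 1 → ⋯ → c (n - 1) → c 0`. Loops (`n = 1`) and pairs of opposite edges (`n = 2`) are
included. -/
def HasDirectedCycle (D : Digraph V) : Prop :=
  ∃ n : ℕ, 1 ≤ n ∧ ∃ c : ℕ → V, Set.InjOn c (Set.Iio n) ∧ c n = c 0 ∧
    ∀ i, i < n → D.Adj (c i) (c (i + 1))

/-- The out-valency of a vertex, as an extended natural number. -/
noncomputable def outValency (D : Digraph V) (x : V) : ℕ∞ :=
  {y : V | D.Adj x y}.encard

/-- The descendant set of `x`. -/
def desc (D : Digraph V) (x : V) : Set V :=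
  {y : V | ∃ s : ℕ, D.HasArc s x y}

/-- The full induced subdigraph on a set of vertices. -/
def induce (D : Digraph V) (X : Set V) : Digraph X where
  Adj a b := D.Adj (a : V) (b : V)

/-- The descendant subdigraph of `x`. -/
abbrev descSubdigraph (D : Digraph V) (x : V) : Digraph (D.desc x) :=
  D.induce (D.desc x)

/-- A rooted (directed) tree with root `r`: there are no loops and no pairs of opposite edges, the
underlying undirected graph is a tree, and there is a directed path from `r` to every vertex. -/
structure IsRootedTree (D : Digraph V) (r : V) : Prop where
  asymm : ∀ x y, D.Adj x y → ¬ D.Adj y x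
  isTree : D.toSimpleGraphInclusive.IsTree
  reach : ∀ x, ∃ s : ℕ, D.HasArc s r x

/-- Every vertex is a descendant of itself. -/
theorem self_mem_desc (D : Digraph V) (x : V) : x ∈ D.desc x :=
  ⟨0, fun _ => x, rfl, rfl, fun _ h => absurd h (Nat.not_lt_zero _), fun _ h => by omega⟩

end Digraph

/-! Acyclicity and distance-transitivity split the descendants of a vertex into disjoint levels on
which its stabiliser is transitive. Hence the size `c n` of level `n`, and the number `s n` of
out-neighbours of `x` leading to a given vertex of its level `n + 1`, are constants, and double
counting gives `p ^ 2 * c n = c (n + 1) * s n`. Primitivity makes a vertex determined by its `n`-th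
level, which forces `s n < p ^ 2`. As `s` is nondecreasing, it is eventually a constant `t`, and
integrality of the recursion leaves `t = 1` or `t = p` (`eq_one_or_eq_prime_of_geometric`).

Suppose `t = p`. The relation generated by common descendants on the out-neighbours of `a` has
classes of size `p` or a single class. In both cases, for an out-neighbour `x` of `a`, all vertices
of `level N x` are reached from the same `p` out-neighbours of `a`. A second one, `b`, then has
`level N x ⊆ level N b`, a contradiction (`branches_ncard_ne_prime`). If `t = 1`, in-neighbours
within a descendant set are unique, and this set is a tree. -/

namespace Digraph

variable {V : Type*} {D : Digraph V}

/-! ### Directed walks and levels -/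

/-- The end points of the directed walks of length `n` that start at `x`. -/
def level (D : Digraph V) : ℕ → V → Set V
  | 0, x => {x}
  | n + 1, x => {z | ∃ y, D.Adj x y ∧ z ∈ level D n y}

theorem mem_level_zero {x z : V} : z ∈ D.level 0 x ↔ z = x := Iff.rfl

theorem mem_level_succ {n : ℕ} {x z : V} :
    z ∈ D.level (n + 1) x ↔ ∃ y, D.Adj x y ∧ z ∈ D.level n y := Iff.rfl

theorem mem_level_one {x z : V} : z ∈ D.level 1 x ↔ D.Adj x z := by
  simp [mem_level_succ, mem_level_zero]

theorem mem_level_add {m n : ℕ} {x z : V} :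
    z ∈ D.level (m + n) x ↔ ∃ y ∈ D.level m x, z ∈ D.level n y := by
  induction m generalizing x with
  | zero => simp [mem_level_zero]
  | succ m ih =>
    rw [Nat.succ_add]
    simp only [mem_level_succ, ih]
    constructor
    · rintro ⟨w, hw, y, hy, hz⟩
      exact ⟨y, ⟨w, hw, hy⟩, hz⟩
    · rintro ⟨y, ⟨w, hw, hy⟩, hz⟩
      exact ⟨w, hw, y, hy, hz⟩

theorem mem_level_of_walk {n : ℕ} {u : ℕ → V} (h : ∀ i < n, D.Adj (u i) (u (i + 1))) :
    u n ∈ D.level n (u 0) := by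
  induction n generalizing u with
  | zero => rfl
  | succ n ih =>
    exact ⟨u 1, h 0 (by omega), ih (u := fun i => u (i + 1)) fun i hi => h (i + 1) (by omega)⟩

theorem exists_walk_of_mem_level {n : ℕ} {x z : V} (h : z ∈ D.level n x) :
    ∃ u : ℕ → V, u 0 = x ∧ u n = z ∧ ∀ i < n, D.Adj (u i) (u (i + 1)) := by
  induction n generalizing x with
  | zero => exact ⟨fun _ => x, rfl, h.symm, fun i hi => by omega⟩
  | succ n ih =>
    obtain ⟨y, hxy, hz⟩ := h
    obtain ⟨u, rfl, rfl, hu⟩ := ih hz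
    refine ⟨fun i => Nat.casesOn i x u, rfl, rfl, ?_⟩
    rintro (_ | i) hi
    · exact hxy
    · exact hu i (by omega)

theorem map_mem_level (g : D.Aut) {n : ℕ} {x z : V} (h : z ∈ D.level n x) :
    g z ∈ D.level n (g x) := by
  induction n generalizing x with
  | zero => exact congrArg g h
  | succ n ih =>
    obtain ⟨y, hy, hz⟩ := h
    exact ⟨g y, g.map_rel_iff.2 hy, ih hz⟩

theorem map_mem_level_iff (g : D.Aut) {n : ℕ} {x z : V} :
    g z ∈ D.level n (g x) ↔ z ∈ D.level n x := by
  refine ⟨fun h => ?_, map_mem_level g⟩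
  simpa using map_mem_level g.symm h

theorem image_level (g : D.Aut) (n : ℕ) (x : V) : g '' D.level n x = D.level n (g x) := by
  ext z
  constructor
  · rintro ⟨w, hw, rfl⟩
    exact map_mem_level g hw
  · intro hz
    refine ⟨g.symm z, ?_, by simp⟩
    rw [← map_mem_level_iff g]
    simpa using hz

theorem level_finite (hfin : ∀ x, {y | D.Adj x y}.Finite) (n : ℕ) (x : V) :
    (D.level n x).Finite := by
  induction n generalizing x with
  | zero => exact Set.finite_singleton x
  | succ n ih =>
    refine ((hfin x).biUnion fun y _ => ih y).subset ?_
    rintro z ⟨y, hy, hz⟩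
    exact Set.mem_biUnion hy hz

theorem level_nonempty (hne : ∀ x, ∃ y, D.Adj x y) (n : ℕ) (x : V) :
    (D.level n x).Nonempty := by
  induction n generalizing x with
  | zero => exact ⟨x, rfl⟩
  | succ n ih =>
    obtain ⟨y, hy⟩ := hne x
    obtain ⟨z, hz⟩ := ih y
    exact ⟨z, y, hy, hz⟩

/-- A shortest closed walk is a directed cycle: a repeated vertex would cut out a shorter closed
walk. -/
theorem not_mem_level_self (hcycle : ¬ D.HasDirectedCycle) {n : ℕ} (hn : 1 ≤ n) (x : V) :
    x ∉ D.level n x := by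
  classical
  intro hx
  have hex : ∃ n, 1 ≤ n ∧ ∃ x, x ∈ D.level n x := ⟨n, hn, x, hx⟩
  obtain ⟨h1, y, hy⟩ := Nat.find_spec hex
  have hmin : ∀ k, 1 ≤ k → k < Nat.find hex → ∀ x, x ∉ D.level k x :=
    fun k hk hlt x hx => Nat.find_min hex hlt ⟨hk, x, hx⟩
  set k := Nat.find hex
  obtain ⟨u, hu0, huk, hu⟩ := exists_walk_of_mem_level hy
  refine hcycle ⟨k, h1, u, ?_, by rw [hu0, huk], hu⟩
  have key : ∀ i j, i < j → j < k → u i ≠ u j := by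
    intro i j hij hj he
    have := mem_level_of_walk (D := D) (n := j - i) (u := fun l => u (i + l))
      fun l hl => hu (i + l) (by omega)
    simp only [add_zero, Nat.add_sub_of_le hij.le] at this
    rw [he] at this
    exact hmin (j - i) (by omega) (by omega) _ this
  intro i hi j hj he
  rcases lt_trichotomy i j with h | h | h
  · exact absurd he (key i j h hj)
  · exact h
  · exact absurd he.symm (key j i h hi)

/-- Without closed walks of length 2, the condition `u i ≠ u (i + 2)` is automatic. -/
theorem hasArc_iff_mem_level (hcycle : ¬ D.HasDirectedCycle) {s : ℕ} {x y : V} :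
    D.HasArc s x y ↔ y ∈ D.level s x := by
  constructor
  · rintro ⟨u, rfl, rfl, hu, -⟩
    exact mem_level_of_walk hu
  · intro h
    obtain ⟨u, h0, hs, hu⟩ := exists_walk_of_mem_level h
    refine ⟨u, h0, hs, hu, fun i hi he => ?_⟩
    refine not_mem_level_self hcycle (n := 2) (by omega) (u i) ?_
    exact ⟨u (i + 1), hu i (by omega), u (i + 2), hu (i + 1) (by omega), he⟩

/-! ### Disjointness of levels; primitivity -/

/-- The levels below a vertex are disjoint. -/
theorem level_disjoint (hcycle : ¬ D.HasDirectedCycle) (hdist : D.IsDistanceTransitive)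
    (hfin : ∀ x, {y | D.Adj x y}.Finite) {s t : ℕ} {x z : V}
    (hs : z ∈ D.level s x) (ht : z ∈ D.level t x) : s = t := by
  have antichain : ∀ (j k : ℕ) (u w : V), 1 ≤ k → D.AtDist j x u → D.AtDist j x w →
      w ∉ D.level k u := by
    intro j k u w hk hu hw hwu
    let S : Set V := {v | D.AtDist j x v}
    have hS : S.Finite := (level_finite hfin j x).subset fun v hv =>
      (hasArc_iff_mem_level hcycle).1 hv.1
    let r : V → V → Prop := fun a b => ∃ k, 1 ≤ k ∧ b ∈ D.level k a
    have : IsTrans V r := ⟨fun a b c ⟨i, hi, hb⟩ ⟨l, _, hc⟩ =>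
      ⟨i + l, by omega, mem_level_add.2 ⟨b, hb, hc⟩⟩⟩
    have : Std.Irrefl r := ⟨fun a ⟨i, hi, h⟩ => not_mem_level_self hcycle hi a h⟩
    have : IsStrictOrder V r := {}
    have hwf : S.WellFoundedOn r := hS.wellFoundedOn
    -- No vertex of `S` lies strictly above `v`, but an automorphism fixing `x` and taking `w` to
    -- `v` takes `u` to such a vertex.
    obtain ⟨⟨v, hv⟩, -, hmin⟩ := WellFounded.has_min hwf Set.univ ⟨⟨u, hu⟩, trivial⟩
    obtain ⟨g, hgx, hgw⟩ := hdist j x w x v hw hv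
    have hgu : D.AtDist j x (g u) := by
      have hmap : ∀ {t : ℕ} {y : V}, D.HasArc t x (g y) ↔ D.HasArc t x y := fun {t y} => by
        rw [hasArc_iff_mem_level hcycle, hasArc_iff_mem_level hcycle]
        conv_lhs => rw [← hgx]
        exact map_mem_level_iff g
      exact ⟨hmap.2 hu.1, fun t ht h => hu.2 t ht (hmap.1 h)⟩
    exact hmin ⟨g u, hgu⟩ trivial ⟨k, hk, hgw ▸ map_mem_level g hwu⟩
  have hgr : ∀ s z, z ∈ D.level s x → D.AtDist s x z := by
    intro s
    induction s using Nat.strong_induction_on with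
    | _ s ih =>
      intro z hz
      refine ⟨(hasArc_iff_mem_level hcycle).2 hz, ?_⟩
      by_contra! hcon
      obtain ⟨t, ⟨hts, htz⟩, htmin⟩ := WellFounded.has_min (wellFounded_lt (α := ℕ))
        {t | t < s ∧ D.HasArc t x z} hcon
      have hdz : D.AtDist t x z := ⟨htz, fun t' ht' h => htmin t' ⟨by omega, h⟩ ht'⟩
      -- The walk of length `s` to `z` passes through some `w` in level `t`; by induction `w` is at
      -- distance `t`, as is `z`, which lies strictly below it.
      obtain ⟨k, rfl⟩ := Nat.exists_eq_add_of_le hts.le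
      obtain ⟨w, hw, hzw⟩ := mem_level_add.1 hz
      exact antichain t k w z (by omega) (ih t hts w hw) hdz hzw
  rcases lt_trichotomy s t with h | h | h
  · exact absurd ((hasArc_iff_mem_level hcycle).2 hs) ((hgr t z ht).2 s h)
  · exact h
  · exact absurd ((hasArc_iff_mem_level hcycle).2 ht) ((hgr s z hs).2 t h)

theorem exists_aut_of_mem_level (hcycle : ¬ D.HasDirectedCycle) (hdist : D.IsDistanceTransitive)
    (hfin : ∀ x, {y | D.Adj x y}.Finite) {n : ℕ} {x y x' y' : V}
    (h : y ∈ D.level n x) (h' : y' ∈ D.level n x') : ∃ g : D.Aut, g x = x' ∧ g y = y' := by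
  have key : ∀ {x y : V}, y ∈ D.level n x → D.AtDist n x y := fun {x y} h =>
    ⟨(hasArc_iff_mem_level hcycle).2 h, fun t ht h2 =>
      ht.ne (level_disjoint hcycle hdist hfin ((hasArc_iff_mem_level hcycle).1 h2) h)⟩
  exact hdist n x y x' y' (key h) (key h')

/-- Having the same `n`-th level is an invariant equivalence relation. Were it universal, `x` and an
out-neighbour would share this level, putting a vertex at depths `n` and `n + 1` below `x`. -/
theorem eq_of_level_eq (hprim : D.IsPrimitive) (hne : ∀ x, ∃ y, D.Adj x y)
    (hlev : ∀ s t x z, z ∈ D.level s x → z ∈ D.level t x → s = t)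
    {n : ℕ} {x x' : V} (h : D.level n x = D.level n x') : x = x' := by
  have : MulAction.IsPreprimitive D.Aut V := hprim
  have hB : MulAction.IsBlock D.Aut {w | D.level n w = D.level n x} := by
    rw [MulAction.isBlock_iff_smul_eq_of_mem]
    intro g a ha hga
    have hg : g '' D.level n x = D.level n x := by
      rw [← show D.level n a = D.level n x from ha, image_level]
      exact (show D.level n (g a) = D.level n x from hga).trans ha.symm
    ext w
    rw [Set.mem_smul_set_iff_inv_smul_mem]
    change D.level n (g.symm w) = D.level n x ↔ D.level n w = D.level n x
    rw [← (Set.image_injective.2 g.injective).eq_iff, image_level, hg]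
    simp
  rcases MulAction.IsPreprimitive.isTrivialBlock_of_isBlock hB with hs | hu
  · exact hs rfl h.symm
  · exfalso
    obtain ⟨y, hy⟩ := hne x
    have hyx : D.level n y = D.level n x := by
      have : y ∈ {w | D.level n w = D.level n x} := hu ▸ Set.mem_univ y
      exact this
    obtain ⟨z, hz⟩ := level_nonempty hne n y
    have := hlev n (n + 1) x z (hyx ▸ hz) ⟨y, hy, hz⟩
    omega

/-! ### Branches, common descendants and counting -/

/-- The out-neighbours of `x` from which `y` is reached in `n` steps. -/
def branches (D : Digraph V) (x : V) (n : ℕ) (y : V) : Set V :=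
  {w | D.Adj x w ∧ y ∈ D.level n w}

theorem branches_subset {x y z : V} {n k : ℕ} (h : z ∈ D.level k y) :
    D.branches x n y ⊆ D.branches x (n + k) z :=
  fun _ hw => ⟨hw.1, mem_level_add.2 ⟨y, hw.2, h⟩⟩

theorem image_branches (g : D.Aut) (x : V) (n : ℕ) (y : V) :
    g '' D.branches x n y = D.branches (g x) n (g y) := by
  ext z
  obtain ⟨w, rfl⟩ := g.surjective z
  rw [g.injective.mem_set_image]
  exact and_congr g.map_rel_iff.symm (map_mem_level_iff g).symm

theorem ncard_dvd_of_class_ncard {A : Set V} (hA : A.Finite) (r : Setoid V) {k : ℕ}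
    (hk : ∀ x ∈ A, {y ∈ A | r x y}.ncard = k) : k ∣ A.ncard := by
  classical
  rw [Set.ncard_eq_toFinset_card A hA,
    Finset.card_eq_sum_card_image (fun x => (Quotient.mk r x)) hA.toFinset]
  refine Finset.dvd_sum fun b hb => ?_
  obtain ⟨x, hx, rfl⟩ := Finset.mem_image.1 hb
  rw [← hk x (hA.mem_toFinset.1 hx), ← Set.ncard_coe_finset]
  refine dvd_of_eq (congrArg _ ?_)
  ext y
  simp only [Finset.coe_filter, Set.Finite.mem_toFinset, Set.mem_ofPred_eq, Quotient.eq]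
  exact and_congr_right fun _ => ⟨fun h => r.symm h, fun h => r.symm h⟩

/-- `x` and `y` have a common descendant. -/
def Meets (D : Digraph V) (x y : V) : Prop :=
  ∃ z i j, z ∈ D.level i x ∧ z ∈ D.level j y

/-- If adjacency through common descendants connects every set of out-neighbours, then it connects
every level. -/
theorem meets_connected_level (hne : ∀ x, ∃ y, D.Adj x y)
    (h1 : ∀ (a : V) (f : V → Prop), (∀ x y, D.Adj a x → D.Adj a y → D.Meets x y → (f x ↔ f y)) →
      ∀ x y, D.Adj a x → D.Adj a y → (f x ↔ f y))
    (n : ℕ) (a : V) (f : V → Prop)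
    (hf : ∀ x ∈ D.level n a, ∀ y ∈ D.level n a, D.Meets x y → (f x ↔ f y)) :
    ∀ x ∈ D.level n a, ∀ y ∈ D.level n a, (f x ↔ f y) := by
  induction n generalizing a with
  | zero =>
    rintro x rfl y rfl
    rfl
  | succ n ih =>
    have hc : ∀ b, D.Adj a b → ∀ x ∈ D.level n b, ∀ y ∈ D.level n b, (f x ↔ f y) :=
      fun b hb => ih b fun x hx y hy => hf x ⟨b, hb, hx⟩ y ⟨b, hb, hy⟩
    have hex : ∀ b, D.Adj a b → ∀ x ∈ D.level n b, ((∃ y ∈ D.level n b, f y) ↔ f x) :=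
      fun b hb x hx => ⟨fun ⟨y, hy, hfy⟩ => (hc b hb y hy x hx).1 hfy, fun h => ⟨x, hx, h⟩⟩
    rintro x ⟨b, hb, hx⟩ y ⟨c, hcc, hy⟩
    rw [← hex b hb x hx, ← hex c hcc y hy]
    refine h1 a (fun b => ∃ y ∈ D.level n b, f y) ?_ b c hb hcc
    rintro b c hb hcc ⟨z, i, j, hzb, hzc⟩
    -- Going `n` steps below `z` ensures that the walks from `b` and `c` cross their `n`-th levels,
    -- at vertices that still meet.
    obtain ⟨z', hz'⟩ := level_nonempty hne n z
    obtain ⟨v, hv, hzv⟩ : ∃ v ∈ D.level n b, z' ∈ D.level i v := by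
      rw [← mem_level_add, add_comm, mem_level_add]
      exact ⟨z, hzb, hz'⟩
    obtain ⟨w, hw, hzw⟩ : ∃ w ∈ D.level n c, z' ∈ D.level j w := by
      rw [← mem_level_add, add_comm, mem_level_add]
      exact ⟨z, hzc, hz'⟩
    rw [hex b hb v hv, hex c hcc w hw]
    exact hf v ⟨b, hb, hv⟩ w ⟨c, hcc, hw⟩ ⟨z', i, j, hzv, hzw⟩

/-- Double counting of the pairs `(w, y)` with `w` an out-neighbour of `x` and `y ∈ D.level n w`. -/
theorem card_level_mul (m : ℕ) (c s : ℕ → ℕ) (hfin : ∀ x, {y | D.Adj x y}.Finite)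
    (hm : ∀ x, {y | D.Adj x y}.ncard = m) (hc : ∀ n x, (D.level n x).ncard = c n)
    (hs : ∀ n x, ∀ y ∈ D.level (n + 1) x, (D.branches x n y).ncard = s n) (x : V) (n : ℕ) :
    m * c n = c (n + 1) * s n := by
  classical
  have hA := hfin x
  have hB := level_finite hfin (n + 1) x
  have := Finset.card_mul_eq_card_mul (s := hA.toFinset) (t := hB.toFinset) (m := c n) (n := s n)
    (fun w y => y ∈ D.level n w) ?_ ?_
  · rwa [← Set.ncard_eq_toFinset_card _ hA, ← Set.ncard_eq_toFinset_card _ hB, hm, hc] at this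
  · intro w hw
    rw [← hc n w, ← Set.ncard_coe_finset]
    congr 1
    ext y
    simp only [Finset.coe_bipartiteAbove, Set.Finite.mem_toFinset, Set.mem_ofPred_eq,
      and_iff_right_iff_imp]
    exact fun hy => ⟨w, hA.mem_toFinset.1 hw, hy⟩
  · intro y hy
    rw [← hs n x y (hB.mem_toFinset.1 hy), ← Set.ncard_coe_finset]
    congr 1
    ext w
    simp [branches]

/-- A recursion `m c(n) = c(n + 1) t` with positive integral solution forces every prime factor of
`t` to divide `m`. -/
theorem prime_dvd_of_geometric {c : ℕ → ℕ} {m t N q : ℕ} (hpos : 0 < c N)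
    (h : ∀ n, N ≤ n → m * c n = c (n + 1) * t) (hq : q.Prime) (hqt : q ∣ t) : q ∣ m := by
  by_contra hqm
  have hgeom : ∀ j, m ^ j * c N = c (N + j) * t ^ j := by
    intro j
    induction j with
    | zero => simp
    | succ j ih =>
      have := h (N + j) (by omega)
      calc m ^ (j + 1) * c N = m * (m ^ j * c N) := by ring
        _ = (m * c (N + j)) * t ^ j := by rw [ih]; ring
        _ = c (N + (j + 1)) * t ^ (j + 1) := by rw [this]; ring_nf
  -- The exponent `c N` suffices: `q ^ c N`, coprime to `m ^ c N`, would divide the smaller positive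
  -- number `c N`.
  have hdvd : q ^ c N ∣ m ^ c N * c N := by
    rw [hgeom]
    exact (pow_dvd_pow_of_dvd hqt _).mul_left _
  have hcop : (q ^ c N).Coprime (m ^ c N) := ((Nat.Prime.coprime_iff_not_dvd hq).2 hqm).pow _ _
  exact absurd (Nat.le_of_dvd hpos (hcop.dvd_of_dvd_mul_left hdvd))
    (not_le.2 (Nat.lt_pow_self hq.one_lt))

theorem eq_one_or_eq_prime_of_geometric {c : ℕ → ℕ} {p t N : ℕ} (hp : p.Prime) (ht : 0 < t)
    (hlt : t < p ^ 2) (hpos : 0 < c N) (h : ∀ n, N ≤ n → p ^ 2 * c n = c (n + 1) * t) :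
    t = 1 ∨ t = p := by
  obtain ht' := Nat.eq_prime_pow_of_unique_prime_dvd ht.ne' (p := p) fun {q} hq hqt =>
    (Nat.prime_dvd_prime_iff_eq hq hp).1
      (hq.dvd_of_dvd_pow (prime_dvd_of_geometric hpos h hq hqt))
  set a := t.primeFactorsList.length
  rw [ht'] at hlt
  have ha : a < 2 := (Nat.pow_lt_pow_iff_right hp.one_lt).1 hlt
  interval_cases a
  · exact Or.inl (by simpa using ht')
  · exact Or.inr (by simpa using ht')

/-! ### Excluding the branch number `p` -/

/-- Either a class of the equivalence relation generated by common descendants on the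
out-neighbours of a vertex consists of `p` vertices, or there is only one class. -/
theorem class_dichotomy {p : ℕ} (hp : p.Prime) (a : V) (hfin : {y | D.Adj a y}.Finite)
    (hm : {y | D.Adj a y}.ncard = p ^ 2)
    (htrans : ∀ x y, D.Adj a x → D.Adj a y → ∃ g : D.Aut, g a = a ∧ g x = y)
    (hbig : ∀ x, D.Adj a x → p ≤ {y | D.Adj a y ∧ D.Meets x y}.ncard) (r : Setoid V)
    (hr : r = Relation.EqvGen.setoid fun x y => D.Adj a x ∧ D.Adj a y ∧ D.Meets x y) :
    (∀ x, D.Adj a x → {y | D.Adj a y ∧ r x y}.ncard = p) ∨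
      ∀ x y, D.Adj a x → D.Adj a y → r x y := by
  have hmap : ∀ g : D.Aut, g a = a → ∀ x y, r x y → r (g x) (g y) := by
    intro g hg x y h
    subst hr
    change Relation.EqvGen _ _ _ at h
    change Relation.EqvGen _ _ _
    induction h with
    | rel x y h =>
      obtain ⟨hx, hy, z, i, j, hi, hj⟩ := h
      refine .rel _ _ ⟨?_, ?_, g z, i, j, map_mem_level g hi, map_mem_level g hj⟩
      · have := g.map_rel_iff.2 hx
        rwa [hg] at this
      · have := g.map_rel_iff.2 hy
        rwa [hg] at this
    | refl x => exact .refl _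
    | symm x y _ ih => exact .symm _ _ ih
    | trans x y z _ _ ih1 ih2 => exact .trans _ _ _ ih1 ih2
  have hle : ∀ x y, D.Adj a x → D.Adj a y →
      {z | D.Adj a z ∧ r x z}.ncard ≤ {z | D.Adj a z ∧ r y z}.ncard := by
    intro x y hx hy
    obtain ⟨g, hg, hgx⟩ := htrans x y hx hy
    refine Set.ncard_le_ncard_of_injOn g ?_ g.injective.injOn (hfin.subset fun z hz => hz.1)
    rintro z ⟨hz, hxz⟩
    refine ⟨?_, hgx ▸ hmap g hg x z hxz⟩
    have := g.map_rel_iff.2 hz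
    rwa [hg] at this
  obtain ⟨x₀, hx₀⟩ : {y | D.Adj a y}.Nonempty :=
    Set.nonempty_of_ncard_ne_zero
      (by rw [hm]; exact pow_ne_zero _ hp.ne_zero)
  have hk : ∀ x, D.Adj a x →
      {z | D.Adj a z ∧ r x z}.ncard = {z | D.Adj a z ∧ r x₀ z}.ncard :=
    fun x hx => le_antisymm (hle x x₀ hx hx₀) (hle x₀ x hx₀ hx)
  have hdvd := ncard_dvd_of_class_ncard hfin r (k := {z | D.Adj a z ∧ r x₀ z}.ncard) hk
  rw [hm, Nat.dvd_prime_pow hp] at hdvd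
  obtain ⟨i, hi, hki⟩ := hdvd
  have hp_le : p ≤ {z | D.Adj a z ∧ r x₀ z}.ncard := by
    refine (hbig x₀ hx₀).trans (Set.ncard_le_ncard ?_ (hfin.subset fun z hz => hz.1))
    rintro y ⟨hy, hxy⟩
    refine ⟨hy, ?_⟩
    subst hr
    exact Relation.EqvGen.rel _ _ ⟨hx₀, hy, hxy⟩
  interval_cases i
  · rw [hki] at hp_le
    exact absurd hp_le (by simpa using hp.one_lt)
  · exact Or.inl fun x hx => (hk x hx).trans (hki.trans (pow_one p))
  · right
    intro x y hx hy
    have : {z | D.Adj a z ∧ r x z} = {z | D.Adj a z} :=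
      Set.eq_of_subset_of_ncard_le (fun z hz => hz.1) (by rw [hk x hx, hki, hm]) hfin
    exact (this.symm ▸ hy : y ∈ {z | D.Adj a z ∧ r x z}).2

/-- Vertices at distance `n + 1` are eventually not reached through exactly `p` out-neighbours. -/
theorem branches_ncard_ne_prime {p : ℕ} (hp : p.Prime) [Nonempty V]
    (hfin : ∀ x, {y | D.Adj x y}.Finite) (hm : ∀ x, {y | D.Adj x y}.ncard = p ^ 2)
    (hne : ∀ x, ∃ y, D.Adj x y)
    (hlev : ∀ s t x z, z ∈ D.level s x → z ∈ D.level t x → s = t)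
    (htrans : ∀ a x y, D.Adj a x → D.Adj a y → ∃ g : D.Aut, g a = a ∧ g x = y)
    (hsub : ∀ n x y, D.level n x ⊆ D.level n y → x = y) (N : ℕ)
    (hN : ∀ n x, N ≤ n → ∀ y ∈ D.level (n + 1) x, (D.branches x n y).ncard = p) : False := by
  have hconn : ∀ a (f : V → Prop),
      (∀ x y, D.Adj a x → D.Adj a y → D.Meets x y → (f x ↔ f y)) →
      ∀ x y, D.Adj a x → D.Adj a y → (f x ↔ f y) := by
    intro a f hf
    have hclass : ∀ x y z, D.Adj a x → z ∈ D.level N x → y ∈ D.branches a N z →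
        D.Adj a y ∧ D.Meets x y := fun x y z _ hz hy => ⟨hy.1, z, N, N, hz, hy.2⟩
    have hbig : ∀ x, D.Adj a x → p ≤ {y | D.Adj a y ∧ D.Meets x y}.ncard := by
      intro x hx
      obtain ⟨z, hz⟩ := level_nonempty hne N x
      rw [← hN N a le_rfl z ⟨x, hx, hz⟩]
      exact Set.ncard_le_ncard (fun y hy => hclass x y z hx hz hy)
        ((hfin a).subset fun y hy => hy.1)
    rcases class_dichotomy hp a (hfin a) (hm a) (htrans a) hbig _ rfl with h | h
    · exfalso
      obtain ⟨x, hx⟩ := hne a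
      obtain ⟨z, hz⟩ := level_nonempty hne N x
      -- Each branch set lies in the class of `x` and has as many elements, so it is the whole
      -- class, whatever `w` is.
      have hsat : ∀ w ∈ D.level N x, D.branches a N w = {y | D.Adj a y ∧
          Relation.EqvGen.setoid (fun x y => D.Adj a x ∧ D.Adj a y ∧ D.Meets x y) x y} := by
        intro w hw
        refine Set.eq_of_subset_of_ncard_le ?_ ?_ ((hfin a).subset fun y hy => hy.1)
        · intro y hy
          obtain ⟨hy1, hy2⟩ := hclass x y w hx hw hy
          exact ⟨hy1, .rel _ _ ⟨hx, hy1, hy2⟩⟩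
        · rw [h x hx, hN N a le_rfl w ⟨x, hx, hw⟩]
      obtain ⟨y, hy, hyx⟩ := Set.exists_ne_of_one_lt_ncard
        (by rw [hN N a le_rfl z ⟨x, hx, hz⟩]; exact hp.one_lt) x
      refine hyx (hsub N x y fun w hw => ?_).symm
      have : y ∈ D.branches a N w := by rwa [hsat w hw, ← hsat z hz]
      exact this.2
    · intro x y hx hy
      have hxy := h x y hx hy
      change Relation.EqvGen _ _ _ at hxy
      clear hx hy
      induction hxy with
      | rel x y h => exact hf x y h.1 h.2.1 h.2.2
      | refl x => rfl
      | symm x y _ ih => exact ih.symm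
      | trans x y z _ _ ih1 ih2 => exact ih1.trans ih2
  obtain ⟨a⟩ := ‹Nonempty V›
  obtain ⟨x, hx⟩ := hne a
  obtain ⟨y, hy⟩ := level_nonempty hne N x
  -- Branch sets can only grow on passing to descendants, and here all have size `p`; so vertices
  -- that meet share their branch set.
  have hstep : ∀ v k z, v ∈ D.level N x → z ∈ D.level k v →
      D.branches a N v = D.branches a (N + k) z := by
    intro v k z hv hz
    refine Set.eq_of_subset_of_ncard_le (branches_subset hz) ?_ ((hfin a).subset fun y hy => hy.1)
    rw [hN N a le_rfl v ⟨x, hx, hv⟩, hN (N + k) a (by omega) z ⟨x, hx, mem_level_add.2 ⟨v, hv, hz⟩⟩]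
  have hconst : ∀ w ∈ D.level N x, D.branches a N w = D.branches a N y := by
    intro w hw
    refine (meets_connected_level hne hconn N x
      (fun v => D.branches a N v = D.branches a N y) ?_ w hw y hy).2 rfl
    rintro v hv u hu ⟨z, i, j, hi, hj⟩
    have hij := hlev (N + i) (N + j) x z (mem_level_add.2 ⟨v, hv, hi⟩)
      (mem_level_add.2 ⟨u, hu, hj⟩)
    rw [hstep v i z hv hi, hstep u j z hu hj, hij]
  obtain ⟨b, hb, hbx⟩ := Set.exists_ne_of_one_lt_ncard
    (by rw [hN N a le_rfl y ⟨x, hx, hy⟩]; exact hp.one_lt) x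
  refine hbx (hsub N x b fun w hw => ?_).symm
  exact (hconst w hw ▸ hb : b ∈ D.branches a N w).2

/-! ### The tree structure when the branch number is 1 -/

/-- If all descendants of out-neighbours are reached through a single out-neighbour, then
in-neighbours within a descendant set are unique. -/
theorem eq_of_adj_of_branches
    (h1 : ∀ n x, ∀ y ∈ D.level (n + 1) x, (D.branches x n y).ncard = 1) {n : ℕ} {x v w z : V}
    (hv : v ∈ D.level n x) (hw : w ∈ D.level n x) (hvz : D.Adj v z) (hwz : D.Adj w z) :
    v = w := by
  induction n generalizing x with
  | zero => exact hv.trans hw.symm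
  | succ n ih =>
    obtain ⟨b, hb, hvb⟩ := hv
    obtain ⟨c, hc, hwc⟩ := hw
    have hzb : z ∈ D.level (n + 1) b := mem_level_add.2 ⟨v, hvb, mem_level_one.2 hvz⟩
    have hzc : z ∈ D.level (n + 1) c := mem_level_add.2 ⟨w, hwc, mem_level_one.2 hwz⟩
    obtain ⟨e, he⟩ := Set.ncard_eq_one.1 (h1 (n + 1) x z ⟨b, hb, hzb⟩)
    have hbe : b ∈ D.branches x (n + 1) z := ⟨hb, hzb⟩
    have hce : c ∈ D.branches x (n + 1) z := ⟨hc, hzc⟩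
    rw [he] at hbe hce
    obtain rfl : b = c := hbe.trans hce.symm
    exact ih hvb hwc

/-- A graph with a height function under which neighbours have distinct heights and every vertex
has at most one lower neighbour is acyclic. -/
theorem _root_.SimpleGraph.isAcyclic_of_height {W : Type*} {G : SimpleGraph W} (ht : W → ℕ)
    (hne : ∀ x y, G.Adj x y → ht x ≠ ht y)
    (huniq : ∀ x y z, G.Adj x y → G.Adj x z → ht y < ht x → ht z < ht x → y = z) :
    G.IsAcyclic := by
  classical
  intro v c hc
  -- At a highest vertex of a cycle both neighbours along the cycle are lower, hence equal.
  obtain ⟨u, hu, hmax⟩ := Finset.exists_max_image c.support.toFinset ht ⟨v, by simp⟩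
  rw [List.mem_toFinset] at hu
  have hc' := hc.rotate hu
  have hlow : ∀ w ∈ (c.rotate u hu).support, G.Adj u w → ht w < ht u := by
    intro w hw hadj
    have : w ∈ c.support := by simpa using hw
    exact lt_of_le_of_ne (hmax w (List.mem_toFinset.2 this)) (hne u w hadj).symm
  have hs := (c.rotate u hu).adj_snd hc'.not_nil
  have hpn := ((c.rotate u hu).adj_penultimate hc'.not_nil).symm
  exact hc'.snd_ne_penultimate (huniq u _ _ hs hpn
    (hlow _ (SimpleGraph.Walk.getVert_mem_support _ _) hs)
    (hlow _ (SimpleGraph.Walk.getVert_mem_support _ _) hpn))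

/-- Depth below `a` is the height function: each edge raises it by one, so lower neighbours are
in-neighbours, which are unique. -/
theorem isRootedTree_descSubdigraph (hcycle : ¬ D.HasDirectedCycle)
    (hlev : ∀ s t x z, z ∈ D.level s x → z ∈ D.level t x → s = t)
    (h1 : ∀ n x, ∀ y ∈ D.level (n + 1) x, (D.branches x n y).ncard = 1) (a : V) :
    (D.descSubdigraph a).IsRootedTree ⟨a, D.self_mem_desc a⟩ := by
  have hreach : ∀ x : D.desc a, ∃ s, (D.descSubdigraph a).HasArc s ⟨a, D.self_mem_desc a⟩ x := by
    rintro ⟨x, hx⟩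
    obtain ⟨s, u, rfl, rfl, hadj, hnb⟩ := hx
    have hmem : ∀ i ≤ s, u i ∈ D.desc (u 0) := fun i hi =>
      ⟨i, u, rfl, rfl, fun j hj => hadj j (by omega), fun j hj => hnb j (by omega)⟩
    -- Past index `s` the values of `u` are arbitrary and may leave the descendant set, hence the
    -- truncation.
    refine ⟨s, fun i => ⟨u (min i s), hmem _ (min_le_right _ _)⟩, ?_, ?_, ?_, ?_⟩
    · simp
    · simp
    · intro i hi
      change D.Adj (u (min i s)) (u (min (i + 1) s))
      rw [min_eq_left hi.le, min_eq_left (Nat.succ_le_of_lt hi)]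
      exact hadj i hi
    · intro i hi he
      have := congrArg Subtype.val he
      simp only [min_eq_left (show i ≤ s by omega), min_eq_left hi] at this
      exact hnb i hi this
  have hdesc : ∀ x : D.desc a, ∃ s, (x : V) ∈ D.level s a := fun x =>
    x.2.imp fun s hs => (hasArc_iff_mem_level hcycle).1 hs
  choose ht hht using hdesc
  have hstep : ∀ x y : D.desc a, D.Adj x y → ht y = ht x + 1 := fun x y hxy =>
    hlev _ _ a y (hht y) (mem_level_add.2 ⟨x, hht x, mem_level_one.2 hxy⟩)
  have hsym : ∀ x y : D.desc a, (D.descSubdigraph a).toSimpleGraphInclusive.Adj x y →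
      D.Adj x y ∨ D.Adj y x := fun x y h => h.2
  have hasymm : ∀ x y : D.desc a, D.Adj x y → ¬ D.Adj y x := by
    intro x y hxy hyx
    have h2 := hstep x y hxy
    have h3 := hstep y x hyx
    omega
  refine ⟨hasymm, ⟨?_, ?_⟩, hreach⟩
  · have hroot : ∀ x : D.desc a, (D.descSubdigraph a).toSimpleGraphInclusive.Reachable
        ⟨a, D.self_mem_desc a⟩ x := by
      intro x
      obtain ⟨s, u, h0, hs, hadj, -⟩ := hreach x
      have : ∀ i ≤ s, (D.descSubdigraph a).toSimpleGraphInclusive.Reachable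
          ⟨a, D.self_mem_desc a⟩ (u i) := by
        intro i hi
        induction i with
        | zero => rw [h0]
        | succ i ih =>
          refine (ih (by omega)).trans (SimpleGraph.Adj.reachable ?_)
          have hd := hadj i (by omega)
          exact ⟨fun he => hasymm _ _ hd (by rw [he] at hd ⊢; exact hd), Or.inl hd⟩
      exact hs ▸ this s le_rfl
    have : Nonempty (D.desc a) := ⟨⟨a, D.self_mem_desc a⟩⟩
    exact SimpleGraph.Connected.mk fun x y => (hroot x).symm.trans (hroot y)
  · refine SimpleGraph.isAcyclic_of_height ht ?_ ?_
    · intro x y hxy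
      rcases hsym x y hxy with h | h
      · have := hstep x y h
        omega
      · have := hstep y x h
        omega
    · intro x y z hxy hxz hy hz
      have hyx : D.Adj y x := (hsym x y hxy).resolve_left fun h => by
        have := hstep x y h
        omega
      have hzx : D.Adj z x := (hsym x z hxz).resolve_left fun h => by
        have := hstep x z h
        omega
      have h2 := hstep y x hyx
      have h3 := hstep z x hzx
      exact Subtype.ext (eq_of_adj_of_branches h1 (hht y)
        ((show ht z = ht y by omega) ▸ hht z) hyx hzx)

end Digraph

/-! ### The main theorem -/

theorem theorem1p1 {V : Type*} [Infinite V] (D : Digraph V)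
    (hprim : D.IsPrimitive) (hdist : D.IsDistanceTransitive)
    (hcycle : ¬ D.HasDirectedCycle)
    (p : ℕ) (hp : p.Prime) (hval : ∀ x : V, D.outValency x = ((p ^ 2 : ℕ) : ℕ∞)) :
    ∀ α : V, (D.descSubdigraph α).IsRootedTree ⟨α, D.self_mem_desc α⟩ := by
  have hfin : ∀ x, {y | D.Adj x y}.Finite := fun x => Set.finite_of_encard_eq_coe (hval x)
  have hm : ∀ x, {y | D.Adj x y}.ncard = p ^ 2 := fun x => by
    rw [Set.ncard, show {y | D.Adj x y}.encard = _ from hval x, ENat.toNat_natCast]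
  have hne : ∀ x, ∃ y, D.Adj x y := fun x =>
    Set.nonempty_of_ncard_ne_zero (s := {y | D.Adj x y})
      (by rw [hm]; exact pow_ne_zero _ hp.ne_zero)
  have hlev : ∀ s t x z, z ∈ D.level s x → z ∈ D.level t x → s = t :=
    fun s t x z => Digraph.level_disjoint hcycle hdist hfin
  have htrans : ∀ {n : ℕ} {x y x' y' : V}, y ∈ D.level n x → y' ∈ D.level n x' →
      ∃ g : D.Aut, g x = x' ∧ g y = y' :=
    Digraph.exists_aut_of_mem_level hcycle hdist hfin
  obtain ⟨a⟩ : Nonempty V := inferInstance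
  obtain ⟨c, hc⟩ : ∃ c : ℕ → ℕ, ∀ n x, (D.level n x).ncard = c n := by
    refine ⟨fun n => (D.level n a).ncard, fun n x => ?_⟩
    obtain ⟨g, hg, -⟩ := htrans (n := 0) (x := a) (x' := x) rfl rfl
    rw [← hg, ← Digraph.image_level, Set.ncard_image_of_injective _ g.injective]
  have hsub : ∀ n x y, D.level n x ⊆ D.level n y → x = y := fun n x y h =>
    Digraph.eq_of_level_eq hprim hne hlev (Set.eq_of_subset_of_ncard_le h (by rw [hc, hc])
      (Digraph.level_finite hfin n y))
  obtain ⟨s, hs⟩ : ∃ s : ℕ → ℕ, ∀ n x, ∀ y ∈ D.level (n + 1) x,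
      (D.branches x n y).ncard = s n := by
    choose y₀ hy₀ using fun n => Digraph.level_nonempty hne (n + 1) a
    refine ⟨fun n => (D.branches a n (y₀ n)).ncard, fun n x y hy => ?_⟩
    obtain ⟨g, hg, hgy⟩ := htrans (hy₀ n) hy
    rw [← hg, ← hgy, ← Digraph.image_branches, Set.ncard_image_of_injective _ g.injective]
  have hbfin : ∀ x n y, (D.branches x n y).Finite := fun x n y =>
    (hfin x).subset fun w hw => hw.1
  have hspos : ∀ n, 0 < s n := fun n => by
    obtain ⟨y, b, hb, hy⟩ := Digraph.level_nonempty hne (n + 1) a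
    rw [← hs n a y ⟨b, hb, hy⟩, Set.ncard_pos (hbfin a n y)]
    exact ⟨b, hb, hy⟩
  have hmono : Monotone s := monotone_nat_of_le_succ fun n => by
    obtain ⟨y, hy⟩ := Digraph.level_nonempty hne (n + 1) a
    obtain ⟨z, hz⟩ := hne y
    have hz' := Digraph.mem_level_one.2 hz
    rw [← hs n a y hy, ← hs (n + 1) a z (Digraph.mem_level_add.2 ⟨y, hy, hz'⟩)]
    exact Set.ncard_le_ncard (Digraph.branches_subset hz') (hbfin _ _ _)
  have hslt : ∀ n, s n < p ^ 2 := by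
    intro n
    have hall : ∀ y ∈ D.level (n + 1) a, D.branches a n y ⊆ {w | D.Adj a w} :=
      fun y _ w hw => hw.1
    by_contra! hle
    -- Otherwise every out-neighbour of `a` would have the whole of level `n + 1` as its `n`-th
    -- level.
    have heq : ∀ y ∈ D.level (n + 1) a, D.branches a n y = {w | D.Adj a w} := fun y hy =>
      Set.eq_of_subset_of_ncard_le (hall y hy) (by rw [hm, hs n a y hy]; exact hle) (hfin a)
    obtain ⟨x, hx⟩ := hne a
    obtain ⟨y, hy, hyx⟩ := Set.exists_ne_of_one_lt_ncard
      (by rw [hm a]; exact Nat.one_lt_pow two_ne_zero hp.one_lt) x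
    refine hyx (hsub n x y fun w hw => ?_).symm
    exact ((heq w ⟨x, hx, hw⟩).symm ▸ hy : y ∈ D.branches a n w).2
  obtain ⟨N, hN⟩ : ∃ N, ∀ n, N ≤ n → s n = s N := by
    have hfinite : (Set.range s).Finite :=
      (Set.finite_Iio (p ^ 2)).subset (Set.range_subset_iff.2 hslt)
    obtain ⟨_, ⟨N, rfl⟩, hmax⟩ := hfinite.exists_maximal (Set.range_nonempty s)
    exact ⟨N, fun n hn => le_antisymm (hmax ⟨n, rfl⟩ (hmono hn)) (hmono hn)⟩
  have hcpos : 0 < c N := by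
    rw [← hc N a, Set.ncard_pos (Digraph.level_finite hfin N a)]
    exact Digraph.level_nonempty hne N a
  rcases Digraph.eq_one_or_eq_prime_of_geometric hp (hspos N) (hslt N) hcpos
    (fun n hn => hN n hn ▸ Digraph.card_level_mul (p ^ 2) c s hfin hm hc hs a n) with h | h
  · refine Digraph.isRootedTree_descSubdigraph hcycle hlev fun n x y hy => ?_
    rw [hs n x y hy]
    -- By monotonicity the eventual value 1 bounds `s n` for small `n` too.
    have h1 := hmono (le_max_left n N)
    rw [hN _ (le_max_right n N), h] at h1
    exact le_antisymm h1 (hspos n)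
  · have : Nonempty V := ⟨a⟩
    exact (Digraph.branches_ncard_ne_prime hp hfin hm hne hlev
      (fun a x y hx hy => htrans (Digraph.mem_level_one.2 hx) (Digraph.mem_level_one.2 hy)) hsub N
      fun n x hn y hy => by rw [hs n x y hy, hN n hn, h]).elim
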